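/- Let $\mathbb K\in\{\mathbb R,\mathbb C\}$. For Banach spaces $X,Y$ over $\mathbb K$ and a bounded linear operator $T:X\to Y$, let $T^*:Y^*\to X^*$ denote its adjoint, let $\mathcal F(X,Y)$ be the set of bounded finite-rank operators $X\to Y$, and let $$\alpha_n(T)=\inf\{\|T-A\| : A\in\mathcal L(X,Y),\ \operatorname{rank}A\le n\},\qquad n=0,1,2,\dots$$ For $0<p<\infty$ let $\ell^p(X,Y)$ be the set of $T\in\mathcal L(X,Y)$ with $\sum_n\alpha_n(T)^p<\infty$, and let $\ell^\infty(X,Y)$ be the set of $T\in\mathcal L(X,Y)$ with $\alpha_n(T)\to0$ (operators of type $\ell^p$). Closures are taken in the operator norm. Then for all Banach spaces $X,Y$: 1. If $T\in\overline{\mathcal F(X,Y)}$, then $\alpha_n(T)=\alpha_n(T^*)$ for all $n\ge 0$. 2. $\ell^\infty(X,Y)=\overline{\mathcal F(X,Y)}$, and $\overline{\ell^p(X,Y)}=\overline{\mathcal F(X,Y)}$ for every $0<p\le\infty$. In particular, $\alpha_n(T)=\alpha_n(T^*)$ for all $n\ge 0$ whenever $T\in\ell^p(X,Y)$, $0<p\le\infty$.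 3. For every $0<p\le\infty$ and every $T\in\mathcal L(X,Y)$: $T\in\ell^p(X,Y)$ if and only if $T^*\in\ell^p(Y^*,X^*)$. Moreover, for every $0<p\le\infty$ the class $\ell^p$, with components $\ell^p(X,Y)$ for Banach spaces $X,Y$ over $\mathbb K$, is a symmetric operator ideal: it contains $I_{\mathbb K}$; if $S_1,S_2\in\ell^p(E,F)$, then $S_1+S_2\in\ell^p(E,F)$; if $S\in\ell^p(E,F)$, $T\in\mathcal L(E_0,E)$ and $R\in\mathcal L(F,F_0)$, then $RST\in\ell^p(E_0,F_0)$; and $\ell^p$ equals its dual ideal, which consists of all operators $T$ between Banach spaces whose adjoint $T^*$ belongs to $\ell^p$. -/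

import Mathlib

open Filter Topology
open scoped ENNReal

universe u v w

noncomputable section

namespace SNumbers

section Operators

variable {𝕜 : Type w} [RCLike 𝕜] {X : Type u} {Y : Type v}
  [NormedAddCommGroup X] [NormedSpace 𝕜 X] [NormedAddCommGroup Y] [NormedSpace 𝕜 Y]

/-- The Banach space adjoint `T* : Y* → X*`, `T* f = f ∘ T`. -/
def dualMap (T : X →L[𝕜] Y) : StrongDual 𝕜 Y →L[𝕜] StrongDual 𝕜 X :=
  ContinuousLinearMap.precomp 𝕜 T

/-- The `n`-th approximation number, with the normalization `α₀(T) = ‖T‖`: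
`α_n(T)` is the distance from `T` to the operators of rank at most `n`. -/
def approxNumber (n : ℕ) (T : X →L[𝕜] Y) : ℝ :=
  sInf {r : ℝ | ∃ A : X →L[𝕜] Y, A.toLinearMap.rank ≤ n ∧ r = ‖T - A‖}

variable (𝕜 X Y)

/-- The finite-rank continuous operators from `X` to `Y`. -/
def finiteRank : Set (X →L[𝕜] Y) :=
  {A | ∃ n : ℕ, A.toLinearMap.rank ≤ n}

/-- The operators of type `ℓ^p`, for `0 < p ≤ ∞`: the sequence `(α_n(T))` is in `ℓ^p` if `p < ∞`,
and in `c₀` if `p = ∞`. -/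
def typeLp (p : ℝ≥0∞) : Set (X →L[𝕜] Y) :=
  {T | (p ≠ ∞ → Summable fun n : ℕ => approxNumber n T ^ p.toReal) ∧
    (p = ∞ → Tendsto (fun n : ℕ => approxNumber n T) atTop (𝓝 0))}

end Operators

section Ideals

/-- A class of continuous operators between Banach spaces (over `𝕜`, in a fixed universe), given by
its components. -/
abbrev OperatorClass (𝕜 : Type) [RCLike 𝕜] : Type (u + 1) :=
  ∀ (E F : Type u) [NormedAddCommGroup E] [NormedSpace 𝕜 E] [CompleteSpace E]
    [NormedAddCommGroup F] [NormedSpace 𝕜 F] [CompleteSpace F], Set (E →L[𝕜] F)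

variable {𝕜 : Type} [RCLike 𝕜]

/-- Operator ideals. `ULift 𝕜` is the scalar field as a Banach space in the given universe. -/
structure IsOperatorIdeal (U : OperatorClass.{u} 𝕜) : Prop where
  id_mem : ContinuousLinearMap.id 𝕜 (ULift.{u} 𝕜) ∈ U (ULift.{u} 𝕜) (ULift.{u} 𝕜)
  add_mem : ∀ (E F : Type u) [NormedAddCommGroup E] [NormedSpace 𝕜 E] [CompleteSpace E]
    [NormedAddCommGroup F] [NormedSpace 𝕜 F] [CompleteSpace F] (S₁ S₂ : E →L[𝕜] F),
    S₁ ∈ U E F → S₂ ∈ U E F → S₁ + S₂ ∈ U E F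
  comp_mem : ∀ (E₀ E F F₀ : Type u)
    [NormedAddCommGroup E₀] [NormedSpace 𝕜 E₀] [CompleteSpace E₀]
    [NormedAddCommGroup E] [NormedSpace 𝕜 E] [CompleteSpace E]
    [NormedAddCommGroup F] [NormedSpace 𝕜 F] [CompleteSpace F]
    [NormedAddCommGroup F₀] [NormedSpace 𝕜 F₀] [CompleteSpace F₀]
    (T : E₀ →L[𝕜] E) (S : E →L[𝕜] F) (R : F →L[𝕜] F₀),
    S ∈ U E F → (R.comp S).comp T ∈ U E₀ F₀

/-- The dual class `U^dual`: all `T` whose adjoint belongs to `U`. -/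
def dualClass (U : OperatorClass.{u} 𝕜) : OperatorClass.{u} 𝕜 :=
  fun E F _ _ _ _ _ _ => {T : E →L[𝕜] F | dualMap T ∈ U (StrongDual 𝕜 F) (StrongDual 𝕜 E)}

/-- A symmetric operator ideal: an operator ideal `U` with `U = U^dual`. -/
structure IsSymmetricIdeal (U : OperatorClass.{u} 𝕜) : Prop extends IsOperatorIdeal U where
  eq_dual : ∀ (E F : Type u) [NormedAddCommGroup E] [NormedSpace 𝕜 E] [CompleteSpace E]
    [NormedAddCommGroup F] [NormedSpace 𝕜 F] [CompleteSpace F], U E F = dualClass U E F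

end Ideals

end SNumbers

end

/-!
The implication from an operator to its adjoint is elementary: the adjoint of an operator of rank
at most `n` has rank at most `n`, so `α_n(T*) ≤ α_n(T)`.

The converse inequality `α_n(T) ≤ α_n(T*)` holds for compact `T` (Hutton's theorem,
`approxNumber_le_approxNumber_dualMap`). It needs only a weak form of local reflexivity
(`exists_norm_sub_lt_of_bidual`): if finitely many points of `Y` are closer than `c k` to
combinations `∑ i, a k i • e i` of vectors `e i` of the bidual, then the `e i` can be replaced by
vectors of `Y`. Otherwise an open product of balls in `Y^κ` would be disjoint from the subspace of
all tuples `(∑ i, a k i • z i)_k`, and a separating functional, which kills that subspace and hence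
also pairs to zero with the tuple of combinations of the `e i`, gives a contradiction.
For Hutton's theorem, a rank-`n` approximation of `T*` is written `g ↦ ∑ i, e i g • f i` with `e i`
in `Y**` and `f i` in `X*`. Compactness of `T` provides a finite net of the unit ball on which
`T x` and `∑ i, f i x • e i` are to be compared, and the replacement of `e i` by `z i` yields the
rank-`n` approximation `x ↦ ∑ i, f i x • z i` of `T` with almost the same error.

Limits of finite-rank operators are exactly the operators with `α_n(T) → 0`, and they are compact,
so `α_n(T) = α_n(T*)` for them. If only `T*` is known to be such a limit, then so is `T**`, hence
also `T** ∘ J = J ∘ T` with `J` the isometric embedding into the bidual; so `T` is compact, Hutton's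
theorem applies, and membership of `T*` in a class `ℓ^p` passes to `T`. The remaining ideal
properties follow from `α_{m+n}(S + T) ≤ α_m(S) + α_n(T)` and
`α_n(RST) ≤ ‖R‖ ‖T‖ α_n(S)`.
-/

namespace SNumbers

section Operators

variable {𝕜 : Type w} [RCLike 𝕜] {X : Type u} {Y : Type v}
  [NormedAddCommGroup X] [NormedSpace 𝕜 X] [NormedAddCommGroup Y] [NormedSpace 𝕜 Y]

/-! ### Replacing vectors of the bidual by vectors of the space -/

theorem exists_norm_lt_re_apply_ge (φ : StrongDual 𝕜 Y) {c d : ℝ} (hd : 0 ≤ d) (hdc : d < c) :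
    ∃ w : Y, ‖w‖ < c ∧ d * ‖φ‖ ≤ RCLike.re (φ w) := by
  have hc : 0 < c := hd.trans_lt hdc
  rcases eq_or_lt_of_le (norm_nonneg φ) with h0 | h0
  · exact ⟨0, by simpa using hc, by simp [← h0]⟩
  · obtain ⟨x, hx, hφ⟩ := φ.exists_lt_apply_of_lt_opNorm (r := d / c * ‖φ‖)
      (mul_lt_of_lt_one_left h0 ((div_lt_one hc).2 hdc))
    have hpos : 0 < ‖φ x‖ := lt_of_le_of_lt (by positivity) hφ
    obtain ⟨s, hs, hsx⟩ : ∃ s : 𝕜, ‖s‖ = 1 ∧ s * φ x = (‖φ x‖ : 𝕜) := by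
      obtain ⟨s, hs, h⟩ := RCLike.exists_norm_eq_mul_self (φ x)
      exact ⟨s, hs, h.symm⟩
    refine ⟨((c : 𝕜) * s) • x, ?_, ?_⟩
    · rw [norm_smul, norm_mul, hs, RCLike.norm_of_nonneg hc.le, mul_one]
      exact mul_lt_of_lt_one_right hc hx
    · rw [map_smul, smul_eq_mul, mul_assoc, hsx, ← RCLike.ofReal_mul, RCLike.ofReal_re]
      have := mul_le_mul_of_nonneg_left hφ.le hc.le
      calc d * ‖φ‖ = c * (d / c * ‖φ‖) := by field_simp
        _ ≤ _ := this

/-- A weak form of the principle of local reflexivity: finitely many strict norm inequalities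
between points of `Y` and combinations of vectors of `Y**` remain true for the same combinations of
suitable vectors of `Y`. -/
theorem exists_norm_sub_lt_of_bidual {ι κ : Type*} [Fintype ι] [Fintype κ]
    (e : ι → StrongDual 𝕜 (StrongDual 𝕜 Y)) (y : κ → Y) (a : κ → ι → 𝕜) (c : κ → ℝ)
    (h : ∀ k, ‖NormedSpace.inclusionInDoubleDual 𝕜 Y (y k) - ∑ i, a k i • e i‖ < c k) :
    ∃ z : ι → Y, ∀ k, ‖y k - ∑ i, a k i • z i‖ < c k := by
  classical
  let _ : NormedSpace ℝ Y := NormedSpace.restrictScalars ℝ 𝕜 Y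
  have : IsScalarTower ℝ 𝕜 Y := RestrictScalars.isScalarTower ℝ 𝕜 Y
  let Φ : (ι → Y) →ₗ[𝕜] (κ → Y) := LinearMap.pi fun k => ∑ i, a k i • LinearMap.proj i
  have hΦ : ∀ z k, Φ z k = ∑ i, a k i • z i := fun z k => by simp [Φ]
  let M : Submodule 𝕜 (κ → Y) := LinearMap.range Φ
  let C : Set (κ → Y) := Set.univ.pi fun k => Metric.ball (y k) (c k)
  by_contra hno
  push Not at hno
  have hdisj : Disjoint C (M : Set (κ → Y)) := by
    rw [Set.disjoint_left]
    rintro _ hC ⟨z, rfl⟩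
    obtain ⟨k, hk⟩ := hno z
    have := hC k (Set.mem_univ k)
    rw [Metric.mem_ball, dist_eq_norm', hΦ] at this
    exact absurd this hk.not_gt
  obtain ⟨φ, s, hC, hM⟩ := RCLike.geometric_hahn_banach_open (𝕜 := 𝕜)
    (convex_pi fun k _ => convex_ball (y k) (c k))
    (isOpen_set_pi Set.finite_univ fun k _ => Metric.isOpen_ball)
    (M.restrictScalars ℝ).convex hdisj
  have hs : s ≤ 0 := by simpa using hM 0 M.zero_mem
  -- A functional whose real part is bounded below on a subspace vanishes there.
  have hφM : ∀ m ∈ M, φ m = 0 := by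
    intro m hm
    by_contra hne
    have := hM ((((s - 1 : ℝ) : 𝕜) / φ m) • m) (M.smul_mem _ hm)
    rw [map_smul, smul_eq_mul, div_mul_cancel₀ _ hne, RCLike.ofReal_re] at this
    linarith
  let ψ : κ → StrongDual 𝕜 Y := fun k => φ.comp (ContinuousLinearMap.single 𝕜 (fun _ : κ => Y) k)
  have hφ : ∀ v, φ v = ∑ k, ψ k (v k) := by
    intro v
    conv_lhs => rw [← Finset.univ_sum_single v]
    simp [ψ, map_sum]
  have hψ : ∀ i, ∑ k, a k i • ψ k = 0 := by
    intro i
    ext v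
    have h1 := hφM (Φ (Pi.single i v)) ⟨_, rfl⟩
    rw [hφ] at h1
    simpa [hΦ, Pi.single_apply, sum_apply] using h1
  -- The relations `∑ k, a k i • ψ k = 0` are all that is needed to evaluate against the `e i`.
  have hpair : ∑ k, (∑ i, a k i • e i) (ψ k) = 0 := by
    have : ∀ i, ∑ k, a k i * e i (ψ k) = 0 := fun i => by
      simpa [map_sum] using congrArg (e i) (hψ i)
    simp only [sum_apply, smul_apply, smul_eq_mul]
    rw [Finset.sum_comm]
    exact Finset.sum_eq_zero fun i _ => this i
  -- Moving inside the balls makes up for the difference between `y k` and `∑ i, a k i • e i`.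
  choose w hw hw' using fun k => exists_norm_lt_re_apply_ge (ψ k)
    (ContinuousLinearMap.opNorm_nonneg _) (h k)
  have hlt : RCLike.re (φ (y + w)) < 0 := by
    refine (hC _ fun k _ => ?_).trans_le hs
    simpa [Metric.mem_ball, dist_eq_norm] using hw k
  have hge : ∀ k, 0 ≤ RCLike.re (ψ k (y k + w k) - (∑ i, a k i • e i) (ψ k)) := by
    intro k
    have h1 := (NormedSpace.inclusionInDoubleDual 𝕜 Y (y k) - ∑ i, a k i • e i).le_opNorm (ψ k)
    have h2 := (abs_le.1 ((RCLike.abs_re_le_norm _).trans h1)).1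
    rw [sub_apply, NormedSpace.dual_def, map_sub] at h2
    rw [map_add, map_sub, map_add]
    linarith [hw' k]
  have := Finset.sum_nonneg fun k (_ : k ∈ Finset.univ) => hge k
  rw [← map_sum, Finset.sum_sub_distrib, hpair, sub_zero] at this
  rw [hφ] at hlt
  exact absurd hlt (not_lt.2 this)

/-! ### Operators of rank at most `n` -/

/-- The operator `A` has rank at most `n`. Stating this for normed spaces fixes the module
structures on dual spaces to be the ones coming from the norm, as in `approxNumber`. -/
def HasRankLE (n : ℕ) (A : X →L[𝕜] Y) : Prop :=
  A.toLinearMap.rank ≤ n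

theorem hasRankLE_iff_exists_sum_smulRight {n : ℕ} {A : X →L[𝕜] Y} :
    HasRankLE n A ↔
      ∃ (f : Fin n → StrongDual 𝕜 X) (y : Fin n → Y), A = ∑ i, (f i).smulRight (y i) := by
  constructor
  · intro h
    let R := LinearMap.range A.toLinearMap
    have hR : Module.rank 𝕜 R ≤ n := h
    have : FiniteDimensional 𝕜 R :=
      Module.rank_lt_aleph0_iff.1 (hR.trans_lt (Cardinal.natCast_lt_aleph0))
    have hfin : Module.finrank 𝕜 R ≤ n := Module.finrank_le_of_rank_le hR
    let b := Module.finBasis 𝕜 R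
    let A' : X →L[𝕜] R := A.codRestrict R fun x => ⟨x, rfl⟩
    let g : Fin (Module.finrank 𝕜 R) → StrongDual 𝕜 X := fun i =>
      (LinearMap.toContinuousLinearMap (b.coord i)).comp A'
    have hA : ∀ x, A x = ∑ i, g i x • (b i : Y) := by
      intro x
      have := congrArg (Subtype.val) (b.sum_repr (A' x))
      rw [Submodule.coe_sum] at this
      exact this.symm
    -- Pad the expansion in a basis of the range with zeros.
    refine ⟨fun i => if hi : (i : ℕ) < Module.finrank 𝕜 R then g ⟨i, hi⟩ else 0,
      fun i => if hi : (i : ℕ) < Module.finrank 𝕜 R then (b ⟨i, hi⟩ : Y) else 0, ?_⟩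
    ext x
    rw [hA, sum_apply]
    rw [← Finset.sum_subset (Finset.subset_univ
      (Finset.univ.map (Fin.castLEEmb hfin)))]
    · simp
    · intro i _ hi
      have : ¬ (i : ℕ) < Module.finrank 𝕜 R := by
        intro hlt
        exact hi (Finset.mem_map.2 ⟨⟨i, hlt⟩, Finset.mem_univ _, rfl⟩)
      simp [this]
  · classical
    rintro ⟨f, y, rfl⟩
    have hle : LinearMap.range (∑ i, (f i).smulRight (y i) : X →L[𝕜] Y).toLinearMap ≤
        Submodule.span 𝕜 ((Finset.univ.image y : Finset Y) : Set Y) := by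
      rintro _ ⟨x, rfl⟩
      simp only [ContinuousLinearMap.coe_coe, sum_apply]
      exact Submodule.sum_mem _ fun i _ => Submodule.smul_mem _ _ (Submodule.subset_span (by simp))
    refine (Submodule.rank_mono hle).trans ((rank_span_finset_le _).trans ?_)
    exact_mod_cast Finset.card_image_le.trans_eq (by simp)

theorem HasRankLE.dualMap {n : ℕ} {A : X →L[𝕜] Y} (h : HasRankLE n A) :
    HasRankLE n (dualMap A) := by
  obtain ⟨f, y, rfl⟩ := hasRankLE_iff_exists_sum_smulRight.1 h
  refine hasRankLE_iff_exists_sum_smulRight.2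
    ⟨fun i => NormedSpace.inclusionInDoubleDual 𝕜 Y (y i), f, ?_⟩
  ext g x
  simp [SNumbers.dualMap, sum_apply, mul_comm]

theorem HasRankLE.add {m n : ℕ} {A B : X →L[𝕜] Y} (hA : HasRankLE m A)
    (hB : HasRankLE n B) : HasRankLE (m + n) (A + B) := by
  exact (LinearMap.rank_add_le _ _).trans ((add_le_add hA hB).trans_eq (Nat.cast_add m n).symm)

theorem HasRankLE.comp_comp {X₀ : Type*} {Y₀ : Type*} [NormedAddCommGroup X₀] [NormedSpace 𝕜 X₀]
    [NormedAddCommGroup Y₀] [NormedSpace 𝕜 Y₀] {n : ℕ} {A : X →L[𝕜] Y}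
    (h : HasRankLE n A) (R : Y →L[𝕜] Y₀) (T : X₀ →L[𝕜] X) :
    HasRankLE n ((R.comp A).comp T) := by
  obtain ⟨f, y, rfl⟩ := hasRankLE_iff_exists_sum_smulRight.1 h
  refine hasRankLE_iff_exists_sum_smulRight.2 ⟨fun i => (f i).comp T, fun i => R (y i), ?_⟩
  ext x
  simp [sum_apply]

/-! ### Approximation numbers -/

theorem norm_dualMap_le (T : X →L[𝕜] Y) : ‖dualMap T‖ ≤ ‖T‖ := by
  refine ContinuousLinearMap.opNorm_le_bound _ (norm_nonneg _) fun g => ?_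
  rw [mul_comm]
  exact ContinuousLinearMap.opNorm_comp_le g T

theorem dualMap_sub (S T : X →L[𝕜] Y) : dualMap (S - T) = dualMap S - dualMap T := by
  ext g x
  simp [dualMap]

theorem dualMap_apply_apply (T : X →L[𝕜] Y) (g : StrongDual 𝕜 Y) (x : X) :
    dualMap T g x = g (T x) := rfl

theorem approxNumber_le_of_hasRankLE {n : ℕ} {A : X →L[𝕜] Y} (hA : HasRankLE n A)
    (T : X →L[𝕜] Y) : approxNumber n T ≤ ‖T - A‖ :=
  csInf_le (show BddBelow {r : ℝ | ∃ A : X →L[𝕜] Y, HasRankLE n A ∧ r = ‖T - A‖} from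
    ⟨0, by rintro _ ⟨_, _, rfl⟩; exact norm_nonneg _⟩) ⟨A, hA, rfl⟩

theorem approxNumber_nonneg (n : ℕ) (T : X →L[𝕜] Y) : 0 ≤ approxNumber n T :=
  Real.sInf_nonneg (by rintro _ ⟨_, _, rfl⟩; exact norm_nonneg _)

theorem exists_hasRankLE_of_approxNumber_lt {n : ℕ} {T : X →L[𝕜] Y} {r : ℝ}
    (h : approxNumber n T < r) : ∃ A : X →L[𝕜] Y, HasRankLE n A ∧ ‖T - A‖ < r := by
  have hne : {r : ℝ | ∃ A : X →L[𝕜] Y, HasRankLE n A ∧ r = ‖T - A‖}.Nonempty :=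
    ⟨‖T - 0‖, 0, by simp [HasRankLE], rfl⟩
  obtain ⟨_, ⟨A, hA, rfl⟩, hr⟩ := exists_lt_of_csInf_lt hne h
  exact ⟨A, hA, hr⟩

theorem approxNumber_antitone (T : X →L[𝕜] Y) {m n : ℕ} (hmn : m ≤ n) :
    approxNumber n T ≤ approxNumber m T := by
  refine le_of_forall_gt_imp_ge_of_dense fun r hr => ?_
  obtain ⟨A, hA, h⟩ := exists_hasRankLE_of_approxNumber_lt hr
  exact (approxNumber_le_of_hasRankLE (hA.trans (Nat.cast_le.2 hmn)) T).trans h.le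

theorem approxNumber_dualMap_le (n : ℕ) (T : X →L[𝕜] Y) :
    approxNumber n (dualMap T) ≤ approxNumber n T := by
  refine le_of_forall_gt_imp_ge_of_dense fun r hr => ?_
  obtain ⟨A, hA, h⟩ := exists_hasRankLE_of_approxNumber_lt hr
  have h1 := approxNumber_le_of_hasRankLE hA.dualMap (dualMap T)
  have h2 := norm_dualMap_le (T - A)
  rw [dualMap_sub] at h2
  exact h1.trans (h2.trans h.le)

theorem approxNumber_add_le (m n : ℕ) (S T : X →L[𝕜] Y) :
    approxNumber (m + n) (S + T) ≤ approxNumber m S + approxNumber n T := by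
  refine le_of_forall_pos_le_add fun ε hε => ?_
  obtain ⟨A, hA, h⟩ := exists_hasRankLE_of_approxNumber_lt
    (lt_add_of_pos_right (approxNumber m S) (half_pos hε))
  obtain ⟨B, hB, h'⟩ := exists_hasRankLE_of_approxNumber_lt
    (lt_add_of_pos_right (approxNumber n T) (half_pos hε))
  refine (approxNumber_le_of_hasRankLE (HasRankLE.add hA hB) _).trans ?_
  rw [add_sub_add_comm]
  linarith [norm_add_le (S - A) (T - B)]

theorem approxNumber_comp_comp_le {X₀ : Type*} {Y₀ : Type*} [NormedAddCommGroup X₀]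
    [NormedSpace 𝕜 X₀] [NormedAddCommGroup Y₀] [NormedSpace 𝕜 Y₀] (n : ℕ) (S : X →L[𝕜] Y)
    (R : Y →L[𝕜] Y₀) (T : X₀ →L[𝕜] X) :
    approxNumber n ((R.comp S).comp T) ≤ ‖R‖ * ‖T‖ * approxNumber n S := by
  have key : ∀ r, approxNumber n S < r → approxNumber n ((R.comp S).comp T) ≤ ‖R‖ * ‖T‖ * r := by
    intro r hr
    obtain ⟨A, hA, h⟩ := exists_hasRankLE_of_approxNumber_lt hr
    refine (approxNumber_le_of_hasRankLE (HasRankLE.comp_comp hA R T) _).trans ?_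
    rw [← ContinuousLinearMap.sub_comp, ← ContinuousLinearMap.comp_sub]
    calc ‖(R.comp (S - A)).comp T‖ ≤ ‖R‖ * ‖S - A‖ * ‖T‖ :=
          (ContinuousLinearMap.opNorm_comp_le _ _).trans
            (mul_le_mul_of_nonneg_right (ContinuousLinearMap.opNorm_comp_le _ _) (norm_nonneg _))
      _ = ‖R‖ * ‖T‖ * ‖S - A‖ := by ring
      _ ≤ ‖R‖ * ‖T‖ * r := by gcongr
  have hlim : Tendsto (fun r => ‖R‖ * ‖T‖ * r) (𝓝[>] approxNumber n S)
      (𝓝 (‖R‖ * ‖T‖ * approxNumber n S)) :=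
    ((continuous_const.mul continuous_id).tendsto _).mono_left nhdsWithin_le_nhds
  refine ge_of_tendsto hlim ?_
  filter_upwards [self_mem_nhdsWithin] with r hr using key r hr

/-! ### Hutton's theorem -/

/-- **Hutton's theorem**, the nontrivial half: a compact operator is approximated by operators of
rank at most `n` as well as its adjoint is. -/
theorem approxNumber_le_approxNumber_dualMap {T : X →L[𝕜] Y} (hT : IsCompactOperator T) (n : ℕ) :
    approxNumber n T ≤ approxNumber n (dualMap T) := by
  classical
  refine le_of_forall_gt_imp_ge_of_dense fun c hc => ?_
  obtain ⟨B, hB, hBc⟩ := exists_hasRankLE_of_approxNumber_lt hc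
  obtain ⟨e, f, rfl⟩ := hasRankLE_iff_exists_sum_smulRight.1 hB
  refine le_of_forall_pos_le_add fun ε hε => ?_
  let K : ℝ := 1 + ∑ i, (‖e i‖ + 1)
  have hK : 0 < K := by positivity
  let δ : ℝ := ε / K
  have hδ : 0 < δ := div_pos hε hK
  -- A finite net for the unit ball with respect to `T` and all the `f i` simultaneously.
  let P : X →L[𝕜] Y × (Fin n → 𝕜) := T.prod (ContinuousLinearMap.pi f)
  have hP : IsCompactOperator P := by
    have h1 := hT.clm_comp (ContinuousLinearMap.inl 𝕜 Y (Fin n → 𝕜))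
    have h2 := (isCompactOperator_of_locallyCompactSpace_dom (ContinuousLinearMap.pi f)).clm_comp
      (ContinuousLinearMap.inr 𝕜 Y (Fin n → 𝕜))
    have h3 : (ContinuousLinearMap.inl 𝕜 Y (Fin n → 𝕜) ∘ T +
        ContinuousLinearMap.inr 𝕜 Y (Fin n → 𝕜) ∘ ContinuousLinearMap.pi f : X → _) = P := by
      funext x
      ext <;> simp [P]
    exact h3 ▸ h1.add h2
  obtain ⟨Q, hQ, hPQ⟩ := hP.image_closedBall_subset_compact (f := P.toLinearMap) 1
  obtain ⟨t, htsub, htfin, ht⟩ := Set.exists_subset_image_finite_and.1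
    (Metric.finite_approx_of_totallyBounded (hQ.totallyBounded.subset hPQ) δ hδ)
  have : Fintype t := htfin.fintype
  -- The points of the net give the approximation of `T`; the additional inequalities
  -- `‖z j‖ < ‖e j‖ + 1` bound the error made in passing to the net.
  obtain ⟨z, hz⟩ := exists_norm_sub_lt_of_bidual e (Sum.elim (fun x : t => T x) fun _ : Fin n => 0)
    (Sum.elim (fun x i => f i x) fun j => Pi.single j 1)
    (Sum.elim (fun _ => c) fun j => ‖e j‖ + 1) (by
      rintro (⟨x, hx⟩ | j)
      · refine lt_of_le_of_lt
          (ContinuousLinearMap.opNorm_le_bound _ (norm_nonneg _) fun g => ?_) hBc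
        have hx1 : ‖x‖ ≤ 1 := by simpa using htsub hx
        have h1 := ((dualMap T - ∑ i, (e i).smulRight (f i)) g).le_opNorm x
        have h2 := (dualMap T - ∑ i, (e i).smulRight (f i)).le_opNorm g
        have h3 : (NormedSpace.inclusionInDoubleDual 𝕜 Y (T x) - ∑ i, f i x • e i) g =
            (dualMap T - ∑ i, (e i).smulRight (f i)) g x := by
          simp [dualMap_apply_apply, sum_apply, mul_comm]
        simp only [Sum.elim_inl]
        rw [h3]
        exact h1.trans ((mul_le_of_le_one_right (norm_nonneg _) hx1).trans h2)
      · have h1 : ∑ i, (Pi.single j 1 : Fin n → 𝕜) i • e i = e j :=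
          (Fintype.sum_eq_single j fun i hi => by
            rw [Pi.single_eq_of_ne hi]; exact zero_smul 𝕜 (e i)).trans
            (by rw [Pi.single_eq_same]; exact one_smul 𝕜 (e j))
        have h2 : ‖(0 : StrongDual 𝕜 (StrongDual 𝕜 Y)) - e j‖ = ‖e j‖ :=
          (norm_sub_rev _ _).trans (congrArg norm (sub_zero (e j)))
        simp only [Sum.elim_inr, map_zero, h1]
        exact h2.trans_lt (lt_add_one _))
  refine (approxNumber_le_of_hasRankLE
    (hasRankLE_iff_exists_sum_smulRight.2 ⟨f, z, rfl⟩) T).trans ?_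
  have hc0 : 0 ≤ c := ((norm_nonneg _).trans_lt hBc).le
  refine ContinuousLinearMap.opNorm_le_of_unit_norm (add_nonneg hc0 hε.le) fun x hx => ?_
  obtain ⟨_, ⟨x', hx't, rfl⟩, hxx'⟩ := Set.mem_iUnion₂.1
    (ht ⟨x, by simpa using hx.le, rfl⟩)
  rw [Metric.mem_ball, dist_eq_norm] at hxx'
  have hT' : ‖T x - T x'‖ ≤ δ := (norm_fst_le _).trans hxx'.le
  have hf' : ∀ i, ‖f i x - f i x'‖ ≤ δ := fun i =>
    (norm_le_pi_norm _ i).trans ((norm_snd_le _).trans hxx'.le)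
  have hz' : ∀ i, ‖z i‖ ≤ ‖e i‖ + 1 := fun i => by
    simpa [Pi.single_apply, ite_smul] using (hz (Sum.inr i)).le
  have hc' : ‖T x' - ∑ i, f i x' • z i‖ ≤ c := (hz (Sum.inl ⟨x', hx't⟩)).le
  have hsum : ‖∑ i, (f i x - f i x') • z i‖ ≤ δ * ∑ i, (‖e i‖ + 1) := by
    rw [Finset.mul_sum]
    refine norm_sum_le_of_le _ fun i _ => ?_
    rw [norm_smul]
    exact mul_le_mul (hf' i) (hz' i) (norm_nonneg _) hδ.le
  have hsplit : (T - ∑ i, (f i).smulRight (z i)) x = (T x - T x') +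
      (T x' - ∑ i, f i x' • z i) - ∑ i, (f i x - f i x') • z i := by
    simp [sum_apply, sub_smul]
  have hδε : δ + δ * ∑ i, (‖e i‖ + 1) = ε := by
    rw [← mul_one_add]
    exact div_mul_cancel₀ ε hK.ne'
  rw [hsplit]
  have := norm_sub_le ((T x - T x') + (T x' - ∑ i, f i x' • z i)) (∑ i, (f i x - f i x') • z i)
  have := norm_add_le (T x - T x') (T x' - ∑ i, f i x' • z i)
  linarith

/-! ### Operators of type `ℓ^p` -/

theorem mem_closure_finiteRank_iff_tendsto {T : X →L[𝕜] Y} :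
    T ∈ closure (finiteRank 𝕜 X Y) ↔ Tendsto (fun n => approxNumber n T) atTop (𝓝 0) := by
  rw [Metric.mem_closure_iff, Metric.tendsto_atTop]
  constructor
  · intro h ε hε
    obtain ⟨A, ⟨n, hA⟩, hTA⟩ := h ε hε
    refine ⟨n, fun m hm => ?_⟩
    rw [Real.dist_0_eq_abs, abs_of_nonneg (approxNumber_nonneg _ _)]
    exact ((approxNumber_antitone T hm).trans (approxNumber_le_of_hasRankLE hA T)).trans_lt
      (dist_eq_norm T A ▸ hTA)
  · intro h ε hε
    obtain ⟨n, hn⟩ := h ε hε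
    have := hn n le_rfl
    rw [Real.dist_0_eq_abs, abs_of_nonneg (approxNumber_nonneg _ _)] at this
    obtain ⟨A, hA, hTA⟩ := exists_hasRankLE_of_approxNumber_lt this
    exact ⟨A, ⟨n, hA⟩, (dist_eq_norm T A).trans_lt hTA⟩

theorem typeLp_top : typeLp 𝕜 X Y ∞ = closure (finiteRank 𝕜 X Y) := by
  ext T
  rw [mem_closure_finiteRank_iff_tendsto]
  simp [typeLp]

theorem finiteRank_subset_typeLp {p : ℝ≥0∞} (hp : 0 < p) :
    finiteRank 𝕜 X Y ⊆ typeLp 𝕜 X Y p := by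
  rintro A ⟨n, hA⟩
  have hzero : ∀ m, n ≤ m → approxNumber m A = 0 := fun m hm =>
    le_antisymm ((approxNumber_antitone A hm).trans
      ((approxNumber_le_of_hasRankLE hA A).trans_eq (by simp))) (approxNumber_nonneg _ _)
  refine ⟨fun hp' => ?_, fun _ =>
    tendsto_const_nhds.congr' (eventually_atTop.2 ⟨n, fun m hm => (hzero m hm).symm⟩)⟩
  refine summable_of_ne_finset_zero (s := Finset.range n) fun m hm => ?_
  rw [hzero m (by simpa using hm), Real.zero_rpow (ENNReal.toReal_pos hp.ne' hp').ne']

theorem typeLp_subset_closure_finiteRank {p : ℝ≥0∞} (hp : 0 < p) :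
    typeLp 𝕜 X Y p ⊆ closure (finiteRank 𝕜 X Y) := by
  intro T hT
  rw [mem_closure_finiteRank_iff_tendsto]
  rcases eq_or_ne p ∞ with hp' | hp'
  · exact hT.2 hp'
  · have hpos := ENNReal.toReal_pos hp.ne' hp'
    have h1 := (hT.1 hp').tendsto_atTop_zero.rpow_const
      (p := p.toReal⁻¹) (Or.inr (inv_nonneg.2 hpos.le))
    rw [Real.zero_rpow (inv_ne_zero hpos.ne')] at h1
    refine h1.congr fun n => ?_
    rw [← Real.rpow_mul (approxNumber_nonneg n T), mul_inv_cancel₀ hpos.ne', Real.rpow_one]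

theorem mem_typeLp_of_approxNumber_le {X' : Type*} {Y' : Type*} [NormedAddCommGroup X']
    [NormedSpace 𝕜 X'] [NormedAddCommGroup Y'] [NormedSpace 𝕜 Y'] {p : ℝ≥0∞}
    {S : X →L[𝕜] Y} {T : X' →L[𝕜] Y'} {C : ℝ} (hC : 0 ≤ C)
    (h : ∀ n, approxNumber n T ≤ C * approxNumber n S) (hS : S ∈ typeLp 𝕜 X Y p) :
    T ∈ typeLp 𝕜 X' Y' p := by
  refine ⟨fun hp => ?_, fun hp => ?_⟩
  · refine Summable.of_nonneg_of_le (fun n => Real.rpow_nonneg (approxNumber_nonneg n T) _)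
      (fun n => ?_) ((hS.1 hp).mul_left (C ^ p.toReal))
    rw [← Real.mul_rpow hC (approxNumber_nonneg n S)]
    exact Real.rpow_le_rpow (approxNumber_nonneg n T) (h n) ENNReal.toReal_nonneg
  · exact squeeze_zero (fun n => approxNumber_nonneg n T) h (by simpa using (hS.2 hp).const_mul C)

theorem dualMap_mem_typeLp {p : ℝ≥0∞} {T : X →L[𝕜] Y} (hT : T ∈ typeLp 𝕜 X Y p) :
    dualMap T ∈ typeLp 𝕜 (StrongDual 𝕜 Y) (StrongDual 𝕜 X) p :=
  mem_typeLp_of_approxNumber_le zero_le_one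
    (fun n => (approxNumber_dualMap_le n T).trans_eq (one_mul _).symm) hT

theorem add_mem_typeLp {p : ℝ≥0∞} {S T : X →L[𝕜] Y} (hS : S ∈ typeLp 𝕜 X Y p)
    (hT : T ∈ typeLp 𝕜 X Y p) : S + T ∈ typeLp 𝕜 X Y p := by
  have hhalf : ∀ n, approxNumber n (S + T) ≤ approxNumber (n / 2) S + approxNumber (n / 2) T :=
    fun n => (approxNumber_antitone (S + T) (show n / 2 + n / 2 ≤ n by omega)).trans
      (approxNumber_add_le _ _ S T)
  have hnn : ∀ n, 0 ≤ approxNumber n S + approxNumber n T := fun n =>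
    add_nonneg (approxNumber_nonneg n S) (approxNumber_nonneg n T)
  refine ⟨fun hp => ?_, fun hp => ?_⟩
  · have hsum : Summable fun n => (approxNumber n S + approxNumber n T) ^ p.toReal := by
      refine Summable.of_nonneg_of_le (fun n => Real.rpow_nonneg (hnn n) _) (fun n => ?_)
        (((hS.1 hp).add (hT.1 hp)).mul_left (2 ^ p.toReal))
      have ha := approxNumber_nonneg n S
      have hb := approxNumber_nonneg n T
      calc (approxNumber n S + approxNumber n T) ^ p.toReal
          ≤ (2 * max (approxNumber n S) (approxNumber n T)) ^ p.toReal := by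
            refine Real.rpow_le_rpow (hnn n) ?_ ENNReal.toReal_nonneg
            linarith [le_max_left (approxNumber n S) (approxNumber n T),
              le_max_right (approxNumber n S) (approxNumber n T)]
        _ = 2 ^ p.toReal * max (approxNumber n S) (approxNumber n T) ^ p.toReal :=
            Real.mul_rpow zero_le_two (ha.trans (le_max_left _ _))
        _ ≤ _ := by
            refine mul_le_mul_of_nonneg_left ?_ (by positivity)
            rcases max_choice (approxNumber n S) (approxNumber n T) with h | h <;> rw [h]
            · exact le_add_of_nonneg_right (Real.rpow_nonneg hb _)
            · exact le_add_of_nonneg_left (Real.rpow_nonneg ha _)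
    have hsum' : Summable fun n : ℕ =>
        (approxNumber (n / 2) S + approxNumber (n / 2) T) ^ p.toReal := by
      refine Summable.even_add_odd ?_ ?_
      · simpa using hsum
      · simpa [Nat.mul_add_div] using hsum
    exact Summable.of_nonneg_of_le (fun n => Real.rpow_nonneg (approxNumber_nonneg n _) _)
      (fun n => Real.rpow_le_rpow (approxNumber_nonneg n _) (hhalf n) ENNReal.toReal_nonneg) hsum'
  · refine squeeze_zero (fun n => approxNumber_nonneg n _) hhalf ?_
    have := (hS.2 hp).add (hT.2 hp)
    rw [add_zero] at this
    exact this.comp (Nat.tendsto_div_const_atTop two_ne_zero)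

theorem comp_comp_mem_typeLp {X₀ : Type*} {Y₀ : Type*} [NormedAddCommGroup X₀]
    [NormedSpace 𝕜 X₀] [NormedAddCommGroup Y₀] [NormedSpace 𝕜 Y₀] {p : ℝ≥0∞} {S : X →L[𝕜] Y}
    (hS : S ∈ typeLp 𝕜 X Y p) (R : Y →L[𝕜] Y₀) (T : X₀ →L[𝕜] X) :
    (R.comp S).comp T ∈ typeLp 𝕜 X₀ Y₀ p :=
  mem_typeLp_of_approxNumber_le (mul_nonneg (norm_nonneg R) (norm_nonneg T))
    (fun n => approxNumber_comp_comp_le n S R T) hS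

/-! ### Compactness and duality -/

theorem isCompactOperator_of_mem_closure_finiteRank [CompleteSpace Y] {T : X →L[𝕜] Y}
    (hT : T ∈ closure (finiteRank 𝕜 X Y)) : IsCompactOperator T := by
  refine closure_minimal (s := finiteRank 𝕜 X Y) (t := {S : X →L[𝕜] Y | IsCompactOperator S})
    ?_ isClosed_setOfPred_isCompactOperator hT
  rintro A ⟨n, hA⟩
  obtain ⟨f, y, rfl⟩ := hasRankLE_iff_exists_sum_smulRight.1 (show HasRankLE n A from hA)
  exact Submodule.sum_mem (compactOperator (RingHom.id 𝕜) X Y) fun i _ =>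
    (isCompactOperator_of_locallyCompactSpace_dom (f i)).clm_comp
      (ContinuousLinearMap.toSpanSingleton 𝕜 (y i))

theorem approxNumber_eq_approxNumber_dualMap [CompleteSpace Y] {T : X →L[𝕜] Y}
    (hT : T ∈ closure (finiteRank 𝕜 X Y)) (n : ℕ) :
    approxNumber n T = approxNumber n (dualMap T) :=
  le_antisymm
    (approxNumber_le_approxNumber_dualMap (isCompactOperator_of_mem_closure_finiteRank hT) n)
    (approxNumber_dualMap_le n T)

theorem isCompactOperator_of_comp_isometry {Z : Type*} [NormedAddCommGroup Z] [NormedSpace 𝕜 Z]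
    [CompleteSpace Y] {T : X →L[𝕜] Y} (J : Y →ₗᵢ[𝕜] Z) (h : IsCompactOperator fun x => J (T x)) :
    IsCompactOperator T := by
  have h' : IsCompactOperator (J.toContinuousLinearMap.comp T) := h
  obtain ⟨K, hK, hKsub⟩ :=
    h'.image_closedBall_subset_compact (f := (J.toContinuousLinearMap.comp T).toLinearMap) 1
  have htb : TotallyBounded (T '' Metric.closedBall 0 1) := by
    rw [← totallyBounded_image_iff J.isometry.isUniformInducing, Set.image_image]
    exact hK.totallyBounded.subset hKsub
  exact (isCompactOperator_iff_image_closedBall_subset_compact T.toLinearMap one_pos).2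
    ⟨_, htb.closure.isCompact_of_isClosed isClosed_closure, subset_closure⟩

/-- The second adjoint of `T` is again a limit of finite-rank operators, and its restriction to `X`
is `T` followed by the isometric embedding of `Y` into its bidual. -/
theorem isCompactOperator_of_dualMap_mem_closure_finiteRank [CompleteSpace Y] {T : X →L[𝕜] Y}
    (hT : dualMap T ∈ closure (finiteRank 𝕜 (StrongDual 𝕜 Y) (StrongDual 𝕜 X))) :
    IsCompactOperator T := by
  rw [← typeLp_top] at hT
  have h1 := dualMap_mem_typeLp hT
  rw [typeLp_top] at h1
  have h2 := (isCompactOperator_of_mem_closure_finiteRank h1).comp_clm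
    (NormedSpace.inclusionInDoubleDual 𝕜 X)
  -- `T** ∘ J = J ∘ T`.
  have h3 : dualMap (dualMap T) ∘ NormedSpace.inclusionInDoubleDual 𝕜 X =
      fun x => NormedSpace.inclusionInDoubleDualLi 𝕜 (T x) := rfl
  rw [h3] at h2
  exact isCompactOperator_of_comp_isometry _ h2

theorem mem_typeLp_iff_dualMap_mem [CompleteSpace Y] {p : ℝ≥0∞} (hp : 0 < p) {T : X →L[𝕜] Y} :
    T ∈ typeLp 𝕜 X Y p ↔ dualMap T ∈ typeLp 𝕜 (StrongDual 𝕜 Y) (StrongDual 𝕜 X) p := by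
  refine ⟨dualMap_mem_typeLp, fun h => mem_typeLp_of_approxNumber_le zero_le_one (fun n => ?_) h⟩
  rw [one_mul]
  exact approxNumber_le_approxNumber_dualMap
    (isCompactOperator_of_dualMap_mem_closure_finiteRank (typeLp_subset_closure_finiteRank hp h)) n

theorem closure_typeLp {p : ℝ≥0∞} (hp : 0 < p) :
    closure (typeLp 𝕜 X Y p) = closure (finiteRank 𝕜 X Y) :=
  (closure_minimal (typeLp_subset_closure_finiteRank hp) isClosed_closure).antisymm
    (closure_mono (finiteRank_subset_typeLp hp))

theorem mem_finiteRank_of_finiteDimensional [FiniteDimensional 𝕜 X] (T : X →L[𝕜] Y) :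
    T ∈ finiteRank 𝕜 X Y := by
  obtain ⟨n, hn⟩ := Cardinal.lt_aleph0.1
    (Module.rank_lt_aleph0 𝕜 (LinearMap.range T.toLinearMap))
  exact ⟨n, hn.le⟩

end Operators

theorem isSymmetricIdeal_typeLp {𝕜 : Type} [RCLike 𝕜] {p : ℝ≥0∞} (hp : 0 < p) :
    IsSymmetricIdeal.{w} (𝕜 := 𝕜) (fun (E F : Type w) _ _ _ _ _ _ => typeLp 𝕜 E F p) where
  id_mem := by
    have : FiniteDimensional 𝕜 (ULift.{w} 𝕜) :=
      Module.Finite.equiv (ULift.moduleEquiv (R := 𝕜) (M := 𝕜)).symm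
    exact finiteRank_subset_typeLp hp (mem_finiteRank_of_finiteDimensional _)
  add_mem _ _ _ _ _ _ _ _ _ _ hS₁ hS₂ := add_mem_typeLp hS₁ hS₂
  comp_mem _ _ _ _ _ _ _ _ _ _ _ _ _ _ _ _ T _ R hS := comp_comp_mem_typeLp hS R T
  eq_dual E F _ _ _ _ _ _ := by
    ext T
    exact mem_typeLp_iff_dualMap_mem hp

end SNumbers

theorem corollary2p4 {𝕜 : Type} [RCLike 𝕜] :
    (∀ (X : Type u) (Y : Type v)
      [NormedAddCommGroup X] [NormedSpace 𝕜 X] [CompleteSpace X]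
      [NormedAddCommGroup Y] [NormedSpace 𝕜 Y] [CompleteSpace Y],
      (∀ T ∈ closure (SNumbers.finiteRank 𝕜 X Y), ∀ n : ℕ,
        SNumbers.approxNumber n T = SNumbers.approxNumber n (SNumbers.dualMap T)) ∧
      SNumbers.typeLp 𝕜 X Y ∞ = closure (SNumbers.finiteRank 𝕜 X Y) ∧
      ∀ p : ℝ≥0∞, 0 < p →
        closure (SNumbers.typeLp 𝕜 X Y p) = closure (SNumbers.finiteRank 𝕜 X Y) ∧
        (∀ T ∈ SNumbers.typeLp 𝕜 X Y p, ∀ n : ℕ,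
          SNumbers.approxNumber n T = SNumbers.approxNumber n (SNumbers.dualMap T)) ∧
        ∀ T : X →L[𝕜] Y, T ∈ SNumbers.typeLp 𝕜 X Y p ↔
          SNumbers.dualMap T ∈ SNumbers.typeLp 𝕜 (StrongDual 𝕜 Y) (StrongDual 𝕜 X) p) ∧
    ∀ p : ℝ≥0∞, 0 < p → SNumbers.IsSymmetricIdeal.{w}
      (fun (E F : Type w) _ _ _ _ _ _ => SNumbers.typeLp 𝕜 E F p) := by
  refine ⟨fun X Y _ _ _ _ _ _ => ⟨fun T hT n => SNumbers.approxNumber_eq_approxNumber_dualMap hT n,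
    SNumbers.typeLp_top, fun p hp => ⟨SNumbers.closure_typeLp hp, fun T hT n => ?_,
      fun T => SNumbers.mem_typeLp_iff_dualMap_mem hp⟩⟩,
    fun p hp => SNumbers.isSymmetricIdeal_typeLp hp⟩
  exact SNumbers.approxNumber_eq_approxNumber_dualMap
    (SNumbers.typeLp_subset_closure_finiteRank hp hT) n
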